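/- Let $R_k^{(\alpha,\beta)}(x)=P_k^{(\alpha,\beta)}(x)/P_k^{(\alpha,\beta)}(1)$, $k\in\mathbf N_0=\{0,1,2,\dots\}$, be the normalized Jacobi polynomials, where $P_k^{(\alpha,\beta)}$ is the Jacobi polynomial of degree $k$ and order $(\alpha,\beta)$. For a sequence $\{m_k\}_{k\ge 0}$ and $\nu\in\mathbf R$ let $$\Delta_2^\nu m_k=\sum_{j=0}^\infty A_j^{-\nu-1}\,m_{k+2j},\qquad A_j^{\mu}=\frac{\Gamma(j+\mu+1)}{\Gamma(j+1)\,\Gamma(\mu+1)}=\frac{(\mu+1)(\mu+2)\cdots(\mu+j)}{j!},$$ whenever the series converges (where $\mu+1$ is a pole of $\Gamma$, $A_j^\mu$ is given by the last expression). For $a\in\mathbf R$ let $[a]^*$ denote the greatest integer strictly smaller than $a$. **Lemma 4.5.** Let $\alpha>-1/2$ and $0<\nu<\alpha+1/2$. Then for all $k\in\mathbf N_0$ and $0<\theta<\pi/2$ the series defining $\Delta_2^\nu R_k^{(\alpha,\alpha)}(\cos\theta)$ converges absolutely, and there is a constant $C$, depending only on $\alpha$ and $\nu$, such that for all $k\in\mathbf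 N_0$ and all $0<\theta<\pi/2$: (a) $|\Delta_2^\nu R_k^{(\alpha,\alpha)}(\cos\theta)|\le C\,(\sin\theta)^\nu$; (b) $|\Delta_2^\nu R_k^{(\alpha,\alpha)}(\cos\theta)|\le C\,(\sin\theta)^{\nu-\alpha-1/2}(k+1)^{-\alpha-1/2}$, where in (b) it is additionally assumed that $\nu\ge[\alpha+1/2]^*$ if $\alpha>1/2$. -/

import Mathlib

open Polynomial

/-- The Jacobi polynomial `P_n^{(a,b)}`, by its explicit expansion at `x = 1`:
`P_n^{(a,b)}(x) = ∑_j (n+a+b+1)_j (a+j+1)_{n-j} / (j! (n-j)!) * ((x-1)/2)^j`,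
where `(z)_j = z (z+1) ⋯ (z+j-1)`. -/
noncomputable def jacobiP (a b : ℝ) (n : ℕ) : ℝ[X] :=
  ∑ j ∈ Finset.range (n + 1),
    C ((ascPochhammer ℝ j).eval ((n : ℝ) + a + b + 1) *
        (ascPochhammer ℝ (n - j)).eval (a + (j : ℝ) + 1) /
        ((j.factorial : ℝ) * ((n - j).factorial : ℝ))) *
      (C (1 / 2 : ℝ) * (X - 1)) ^ j

/-- The normalized Jacobi polynomial `R_n^{(a,b)}(x) = P_n^{(a,b)}(x) / P_n^{(a,b)}(1)`. -/
noncomputable def jacobiR (a b : ℝ) (n : ℕ) (x : ℝ) : ℝ :=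
  (jacobiP a b n).eval x / (jacobiP a b n).eval 1

/-- The coefficient `A_j^μ = Γ(j+μ+1) / (Γ(j+1) Γ(μ+1)) = (μ+1)(μ+2)⋯(μ+j) / j!`. The product form
also gives the value (the limit) where `μ + 1` is a pole of `Γ`; for the agreement with the
quotient of Gamma functions at all other `μ` see `cesaroA_eq_Gamma`. -/
noncomputable def cesaroA (μ : ℝ) (j : ℕ) : ℝ :=
  (ascPochhammer ℝ j).eval (μ + 1) / (j.factorial : ℝ)

theorem cesaroA_eq_Gamma (μ : ℝ) (hμ : ∀ m : ℕ, μ + 1 ≠ -(m : ℝ)) (j : ℕ) :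
    cesaroA μ j =
      Real.Gamma ((j : ℝ) + μ + 1) / (Real.Gamma ((j : ℝ) + 1) * Real.Gamma (μ + 1)) := by
  have h0 : Real.Gamma (μ + 1) ≠ 0 := Real.Gamma_ne_zero hμ
  have key : ∀ i : ℕ, Real.Gamma ((i : ℝ) + μ + 1) =
      (ascPochhammer ℝ i).eval (μ + 1) * Real.Gamma (μ + 1) := by
    intro i
    induction i with
    | zero => simp
    | succ i ih =>
      have hne : (i : ℝ) + μ + 1 ≠ 0 := fun h => hμ i (by linarith)
      rw [ascPochhammer_succ_eval]
      have : ((i + 1 : ℕ) : ℝ) + μ + 1 = ((i : ℝ) + μ + 1) + 1 := by push_cast; ring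
      rw [this, Real.Gamma_add_one hne, ih]
      ring
  rw [cesaroA, key j, Real.Gamma_nat_eq_factorial]
  field_simp

/-- The `j`-th term of the series that defines the fractional difference `Δ_κ^μ m_k`. -/
noncomputable def fracDiffTerm (κ : ℕ) (μ : ℝ) (m : ℕ → ℝ) (k j : ℕ) : ℝ :=
  cesaroA (-μ - 1) j * m (k + κ * j)

/-- The fractional difference `Δ_κ^μ m_k = ∑_{j ≥ 0} A_j^{-μ-1} m_{k+κj}` of order `μ` with
increment `κ`. It is meaningful where `fracDiffTerm κ μ m k` is summable. -/
noncomputable def fracDiff (κ : ℕ) (μ : ℝ) (m : ℕ → ℝ) (k : ℕ) : ℝ :=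
  ∑' j : ℕ, fracDiffTerm κ μ m k j

/-- `[a]^*`, the greatest integer (strictly) smaller than `a`. -/
noncomputable def greatestIntLT (a : ℝ) : ℤ := ⌈a⌉ - 1

theorem isGreatest_greatestIntLT (a : ℝ) :
    IsGreatest {n : ℤ | (n : ℝ) < a} (greatestIntLT a) := by
  constructor
  · have := Int.ceil_lt_add_one a
    change ((⌈a⌉ - 1 : ℤ) : ℝ) < a
    push_cast
    linarith
  · intro n hn
    have hn' : (n : ℝ) < a := hn
    have := Int.lt_ceil.2 hn'
    simp only [greatestIntLT]
    omega

/-!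
For `e = exp (iθ)`, Gegenbauer's integral writes `R_n^{(α,α)}(cos θ)` as the mean of `z ^ n` for a
point `z` of the vertical chord from `e⁻¹` to `e` chosen according to the symmetric Beta
distribution with parameter `α + 1 / 2`: integration by parts shows that these means satisfy the
three-term recurrence of the ultraspherical polynomials. Summing the binomial series under the
integral, `Δ_2^ν R_k^{(α,α)}(cos θ)` becomes the mean of `z ^ k (1 - z ^ 2) ^ ν`, and
`|1 - z ^ 2| ≤ |e - e⁻¹| = 2 sin θ` on the chord gives (a).

For (b), the Beta density is, up to a constant factor, the restriction to the chord of
`((1 - z e) (1 - z e⁻¹)) ^ (α - 1 / 2)`, which is holomorphic in the disc. Cauchy's theorem moves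
the integral to the two radii ending at `e` and `e⁻¹`, where `|z| ^ k` decays exponentially at scale
`1 / (k + 1)` from the circle. This gives (b) when `(k + 1) |e - e⁻¹| ≥ 1`; otherwise (b) follows
from (a).
-/

open MeasureTheory Set Filter Topology ProbabilityTheory

/-! ### Jacobi polynomials -/

/-- The coefficient of `((x - 1) / 2) ^ j` in the normalized Jacobi polynomial `R_n^{(a,b)}`. -/
noncomputable def jacobiRCoeff (a b : ℝ) (n j : ℕ) : ℝ :=
  n.choose j * (ascPochhammer ℝ j).eval (n + (a + b + 1)) / (ascPochhammer ℝ j).eval (a + 1)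

/-- The polynomial `Q` with `R_n^{(a,b)}(x) = Q((x - 1) / 2)`. -/
noncomputable def shiftedJacobiR (a b : ℝ) (n : ℕ) : ℝ[X] :=
  ∑ j ∈ Finset.range (n + 1), monomial j (jacobiRCoeff a b n j)

theorem ascPochhammer_eval_add (x : ℝ) (m n : ℕ) :
    (ascPochhammer ℝ (m + n)).eval x =
      (ascPochhammer ℝ m).eval x * (ascPochhammer ℝ n).eval (x + m) := by
  rw [← ascPochhammer_mul]
  simp

theorem ascPochhammer_succ_eval_left (x : ℝ) (n : ℕ) :
    (ascPochhammer ℝ (n + 1)).eval x = x * (ascPochhammer ℝ n).eval (x + 1) := by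
  rw [add_comm, ascPochhammer_eval_add, ascPochhammer_one, eval_X, Nat.cast_one]

theorem jacobiP_eval_one (a b : ℝ) (n : ℕ) :
    (jacobiP a b n).eval 1 = (ascPochhammer ℝ n).eval (a + 1) / n.factorial := by
  rw [jacobiP, eval_finsetSum, Finset.sum_range_succ']
  simp

theorem jacobiR_eq_eval_shiftedJacobiR {a : ℝ} (ha : -1 < a) (b : ℝ) (n : ℕ) (x : ℝ) :
    jacobiR a b n x = (shiftedJacobiR a b n).eval ((x - 1) / 2) := by
  rw [jacobiR, jacobiP_eval_one, jacobiP, shiftedJacobiR, eval_finsetSum, eval_finsetSum,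
    Finset.sum_div]
  refine Finset.sum_congr rfl fun j hj ↦ ?_
  have hjn : j ≤ n := Nat.lt_succ_iff.1 (Finset.mem_range.1 hj)
  have hsplit : (ascPochhammer ℝ n).eval (a + 1) =
      (ascPochhammer ℝ j).eval (a + 1) * (ascPochhammer ℝ (n - j)).eval (a + j + 1) := by
    rw [add_right_comm a, ← ascPochhammer_eval_add, Nat.add_sub_cancel' hjn]
  have hj0 : 0 < (ascPochhammer ℝ j).eval (a + 1) := ascPochhammer_pos _ _ (by linarith)
  have hnj0 : 0 < (ascPochhammer ℝ (n - j)).eval (a + j + 1) :=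
    ascPochhammer_pos _ _ (by linarith [j.cast_nonneg (α := ℝ)])
  rw [hsplit, eval_monomial, jacobiRCoeff, Nat.cast_choose ℝ hjn,
    show (n : ℝ) + a + b + 1 = n + (a + b + 1) by ring]
  simp only [eval_mul, eval_C, eval_pow, eval_sub, eval_X, eval_one, one_div_mul_eq_div]
  field_simp

theorem coeff_shiftedJacobiR (a b : ℝ) (n j : ℕ) :
    (shiftedJacobiR a b n).coeff j = jacobiRCoeff a b n j := by
  simp only [shiftedJacobiR, finsetSum_coeff, coeff_monomial, Finset.sum_ite_eq',
    Finset.mem_range]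
  split_ifs with h
  · rfl
  · simp [jacobiRCoeff, Nat.choose_eq_zero_of_lt (by omega : n < j)]

theorem jacobiRCoeff_zero_right (a b : ℝ) (n : ℕ) : jacobiRCoeff a b n 0 = 1 := by
  simp [jacobiRCoeff]

theorem jacobiRCoeff_succ_right {a : ℝ} (ha : -1 < a) (b : ℝ) (n i : ℕ) :
    (i + 1) * (a + 1 + i) * jacobiRCoeff a b n (i + 1) =
      (n - i) * (n + (a + b + 1) + i) * jacobiRCoeff a b n i := by
  have hpos : 0 < (ascPochhammer ℝ i).eval (a + 1) := ascPochhammer_pos _ _ (by linarith)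
  have hai : 0 < a + 1 + i := by linarith [i.cast_nonneg (α := ℝ)]
  have hchoose : (n.choose (i + 1) : ℝ) * (i + 1) = n.choose i * (n - i) := by
    rcases le_or_gt i n with h | h
    · exact_mod_cast congrArg (Nat.cast (R := ℝ)) (Nat.choose_succ_right_eq n i)
    · simp [Nat.choose_eq_zero_of_lt h, Nat.choose_eq_zero_of_lt (h.trans i.lt_succ_self)]
  simp only [jacobiRCoeff, ascPochhammer_succ_eval]
  field_simp
  linear_combination (ascPochhammer ℝ i).eval (n + (a + b + 1)) * (n + (a + b + 1) + i) * hchoose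

theorem jacobiRCoeff_succ_left (a b : ℝ) (n i : ℕ) :
    (n + 1 - i) * (n + (a + b + 1)) * jacobiRCoeff a b (n + 1) i =
      (n + 1) * (n + (a + b + 1) + i) * jacobiRCoeff a b n i := by
  have hchoose : (n.choose i : ℝ) * (n + 1) = (n + 1).choose i * (n + 1 - i) := by
    rcases le_or_gt i (n + 1) with h | h
    · exact_mod_cast congrArg (Nat.cast (R := ℝ)) (Nat.choose_mul_succ_eq n i)
    · simp [Nat.choose_eq_zero_of_lt h, Nat.choose_eq_zero_of_lt (n.lt_succ_self.trans h)]
  have hpoch := (ascPochhammer_succ_eval_left (n + (a + b + 1)) i).symm.trans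
    (ascPochhammer_succ_eval i (n + (a + b + 1)))
  simp only [jacobiRCoeff, Nat.cast_add_one, mul_div_assoc', add_right_comm (n : ℝ) 1]
  congr 1
  linear_combination (n + 1 - i) * (n + 1).choose i * hpoch -
    (ascPochhammer ℝ i).eval (n + (a + b + 1)) * (n + (a + b + 1) + i) * hchoose

theorem jacobiRCoeff_self_recurrence {a : ℝ} (ha : -1 < a) (m i : ℕ) :
    (m + 1 + (2 * a + 1)) * jacobiRCoeff a a (m + 2) (i + 1) =
      (2 * (m + 1) + (2 * a + 1)) *
          (jacobiRCoeff a a (m + 1) (i + 1) + 2 * jacobiRCoeff a a (m + 1) i) -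
        (m + 1) * jacobiRCoeff a a m (i + 1) := by
  have hi : ((i : ℝ) + 1) * (a + 1 + i) ≠ 0 :=
    mul_ne_zero (by positivity) (by linarith [i.cast_nonneg (α := ℝ)])
  have hright₂ := jacobiRCoeff_succ_right ha a (m + 2) i
  have hright₁ := jacobiRCoeff_succ_right ha a (m + 1) i
  have hright₀ := jacobiRCoeff_succ_right ha a m i
  have hleft₁ := jacobiRCoeff_succ_left a a (m + 1) i
  have hleft₀ := jacobiRCoeff_succ_left a a m i
  push_cast at hright₂ hright₁ hleft₁
  refine mul_left_cancel₀ hi ?_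
  linear_combination (m + 1 + (2 * a + 1)) * hright₂ + (m + 2 + (2 * a + 1) + i) * hleft₁ -
    (2 * (m + 1) + (2 * a + 1)) * hright₁ + (m + 1) * hright₀ - (m - i) * hleft₀

theorem shiftedJacobiR_self_recurrence {a : ℝ} (ha : -1 < a) (m : ℕ) :
    C (m + 1 + (2 * a + 1)) * shiftedJacobiR a a (m + 2) =
      C (2 * (m + 1) + (2 * a + 1)) *
          (shiftedJacobiR a a (m + 1) + C 2 * (X * shiftedJacobiR a a (m + 1))) -
        C (m + 1 : ℝ) * shiftedJacobiR a a m := by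
  ext (_ | i)
  · simp only [coeff_C_mul, coeff_sub, coeff_add, coeff_shiftedJacobiR, coeff_X_mul_zero,
      jacobiRCoeff_zero_right]
    ring
  · simpa only [coeff_C_mul, coeff_sub, coeff_add, coeff_shiftedJacobiR, coeff_X_mul] using
      jacobiRCoeff_self_recurrence ha m i

theorem jacobiR_zero {a : ℝ} (ha : -1 < a) (b x : ℝ) : jacobiR a b 0 x = 1 := by
  simp [jacobiR_eq_eval_shiftedJacobiR ha, shiftedJacobiR, jacobiRCoeff_zero_right]

theorem jacobiR_self_one {a : ℝ} (ha : -1 < a) (x : ℝ) : jacobiR a a 1 x = x := by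
  have : a + 1 ≠ 0 := by linarith
  simp [jacobiR_eq_eval_shiftedJacobiR ha, shiftedJacobiR, Finset.sum_range_succ, jacobiRCoeff]
  field_simp
  ring

theorem jacobiR_self_recurrence {a : ℝ} (ha : -1 < a) (x : ℝ) (m : ℕ) :
    (m + 1 + (2 * a + 1)) * jacobiR a a (m + 2) x =
      (2 * (m + 1) + (2 * a + 1)) * x * jacobiR a a (m + 1) x - (m + 1) * jacobiR a a m x := by
  have h := congrArg (eval ((x - 1) / 2)) (shiftedJacobiR_self_recurrence ha m)
  simp only [eval_mul, eval_sub, eval_add, eval_C, eval_X] at h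
  simp only [jacobiR_eq_eval_shiftedJacobiR ha]
  linear_combination h

/-! ### Cesàro numbers -/

theorem cesaroA_eq_multichoose (μ : ℝ) (j : ℕ) : cesaroA μ j = Ring.multichoose (μ + 1) j := by
  have h := Ring.factorial_nsmul_multichoose_eq_ascPochhammer (μ + 1) j
  rw [ascPochhammer_smeval_eq_eval, nsmul_eq_mul] at h
  rw [cesaroA, ← h, mul_div_cancel_left₀ _ (by positivity)]

theorem cesaroA_succ (μ : ℝ) (j : ℕ) :
    (j + 1) * cesaroA μ (j + 1) = (μ + 1 + j) * cesaroA μ j := by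
  rw [cesaroA, cesaroA, ascPochhammer_succ_eval, Nat.factorial_succ]
  push_cast
  field_simp

theorem mul_abs_cesaroA_eq_sub {ν : ℝ} {j : ℕ} (hj : ν ≤ j) :
    ν * |cesaroA (-ν - 1) j| =
      j * |cesaroA (-ν - 1) j| - (j + 1 : ℕ) * |cesaroA (-ν - 1) (j + 1)| := by
  have h := congrArg abs (cesaroA_succ (-ν - 1) j)
  rw [abs_mul, abs_mul, abs_of_nonneg (by positivity : (0 : ℝ) ≤ j + 1),
    abs_of_nonneg (by linarith : 0 ≤ -ν - 1 + 1 + j)] at h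
  push_cast
  linarith

theorem summable_abs_cesaroA {ν : ℝ} (hν : 0 ≤ ν) : Summable fun j ↦ |cesaroA (-ν - 1) j| := by
  rcases hν.eq_or_lt with rfl | hν
  · refine summable_of_ne_finset_zero (s := {0}) fun j hj ↦ ?_
    obtain ⟨i, rfl⟩ := Nat.exists_eq_succ_of_ne_zero (by simpa using hj)
    simp [cesaroA]
  obtain ⟨N, hN⟩ := exists_nat_ge ν
  rw [← summable_nat_add_iff N]
  set s : ℕ → ℝ := fun j ↦ (j + N : ℕ) * |cesaroA (-ν - 1) (j + N)|
  have hstep (j : ℕ) : ν * |cesaroA (-ν - 1) (j + N)| = s j - s (j + 1) := by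
    rw [mul_abs_cesaroA_eq_sub (hN.trans (by simp))]
    simp only [s, add_right_comm]
  refine summable_of_sum_range_le (c := s 0 / ν) (fun _ ↦ abs_nonneg _) fun n ↦ ?_
  rw [le_div_iff₀' hν, Finset.mul_sum, Finset.sum_congr rfl fun j _ ↦ hstep j,
    Finset.sum_range_sub']
  exact sub_le_self _ (by positivity)

theorem hasSum_cesaroA_mul_pow (ν : ℝ) {u : ℂ} (hu : ‖u‖ < 1) :
    HasSum (fun j ↦ (cesaroA (-ν - 1) j : ℂ) * u ^ j) ((1 - u) ^ (ν : ℂ)) := by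
  have h := (Complex.one_div_one_sub_cpow_hasFPowerSeriesOnBall_zero (-(ν : ℂ))).hasSum
    (y := u) (by simpa [enorm_eq_nnnorm, ← NNReal.coe_lt_coe] using hu)
  simp only [zero_add, Complex.cpow_neg, one_div, inv_inv] at h
  convert! h using 2 with j
  have hcast : ((Ring.multichoose (-ν) j : ℝ) : ℂ) = Ring.multichoose (-(ν : ℂ)) j := by
    simpa using Ring.map_multichoose (algebraMap ℝ ℂ) (-ν) j
  rw [FormalMultilinearSeries.ofScalars_apply_eq, ← Ring.multichoose_eq,
    cesaroA_eq_multichoose, sub_add_cancel, hcast, smul_eq_mul]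

/-! ### Beta distribution -/

theorem intervalIntegrable_rpow_mul_one_sub_rpow {p q : ℝ} (hp : 0 < p) (hq : 0 < q) :
    IntervalIntegrable (fun x : ℝ ↦ x ^ (p - 1) * (1 - x) ^ (q - 1)) volume 0 1 := by
  refine (Complex.betaIntegral_convergent (u := p) (v := q) (by simpa) (by simpa)).norm.congr
    fun x hx ↦ ?_
  rw [uIoc_of_le zero_le_one] at hx
  have hx' : 0 ≤ 1 - x := sub_nonneg.2 hx.2
  rw [← Complex.ofReal_one, ← Complex.ofReal_sub, ← Complex.ofReal_sub, ← Complex.ofReal_sub,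
    ← Complex.ofReal_cpow hx.1.le, ← Complex.ofReal_cpow hx', norm_mul,
    Complex.norm_of_nonneg (Real.rpow_nonneg hx.1.le _),
    Complex.norm_of_nonneg (Real.rpow_nonneg hx' _)]

theorem measurable_betaPDF (p q : ℝ) : Measurable (betaPDF p q) :=
  (measurable_betaPDFReal p q).ennreal_ofReal

theorem ae_betaMeasure_mem_Ioo (p q : ℝ) : ∀ᵐ x ∂betaMeasure p q, x ∈ Ioo (0 : ℝ) 1 := by
  rw [betaMeasure, ae_withDensity_iff (measurable_betaPDF p q)]
  refine Eventually.of_forall fun x hx ↦ ⟨?_, ?_⟩ <;> by_contra! h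
  · exact hx (betaPDF_eq_zero_of_nonpos h)
  · exact hx (betaPDF_eq_zero_of_one_le h)

theorem integral_betaMeasure {E : Type*} [NormedAddCommGroup E] [NormedSpace ℝ E] {p q : ℝ}
    (hp : 0 < p) (hq : 0 < q) (f : ℝ → E) :
    ∫ x, f x ∂betaMeasure p q =
      (beta p q)⁻¹ • ∫ x in (0 : ℝ)..1, (x ^ (p - 1) * (1 - x) ^ (q - 1)) • f x := by
  have hdensity (x : ℝ) : (betaPDF p q x).toReal • f x = (Ioo (0 : ℝ) 1).indicator
      (fun x ↦ (beta p q)⁻¹ • (x ^ (p - 1) * (1 - x) ^ (q - 1)) • f x) x := by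
    by_cases hx : x ∈ Ioo (0 : ℝ) 1
    · rw [indicator_of_mem hx, betaPDF, ENNReal.toReal_ofReal (betaPDFReal_pos hx.1 hx.2 hp hq).le,
        betaPDFReal, if_pos (show 0 < x ∧ x < 1 from hx), one_div, smul_smul, mul_assoc]
    · rw [indicator_of_notMem hx, betaPDF, betaPDFReal, if_neg (show ¬(0 < x ∧ x < 1) from hx)]
      simp
  rw [betaMeasure, integral_withDensity_eq_integral_toReal_smul
    (measurable_betaPDF p q) (by simp [betaPDF])]
  simp only [hdensity]
  rw [integral_indicator measurableSet_Ioo, integral_smul, ← integral_Ioc_eq_integral_Ioo,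
    ← intervalIntegral.integral_of_le zero_le_one]

theorem integrable_betaMeasure_of_continuous {E : Type*} [NormedAddCommGroup E]
    {p q : ℝ} (hp : 0 < p) (hq : 0 < q) {f : ℝ → E} (hf : Continuous f) :
    Integrable f (betaMeasure p q) := by
  have := isProbabilityMeasureBeta hp hq
  obtain ⟨M, hM⟩ := isCompact_Icc.exists_bound_of_continuousOn (hf.continuousOn (s := Icc 0 1))
  refine .of_bound hf.aestronglyMeasurable M ?_
  filter_upwards [ae_betaMeasure_mem_Ioo p q] with x hx using hM x (Ioo_subset_Icc_self hx)

theorem integral_betaMeasure_stein {p q : ℝ} (hp : 0 < p) (hq : 0 < q) {f f' : ℝ → ℂ}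
    (hf : ∀ x, HasDerivAt f (f' x) x) (hf' : Continuous f') :
    ∫ x, (x * (1 - x) * f' x + (p - (p + q) * x) * f x) ∂betaMeasure p q = 0 := by
  have hcont : Continuous f := continuous_iff_continuousAt.2 fun x ↦ (hf x).continuousAt
  set w : ℝ → ℝ := fun x ↦ x ^ p * (1 - x) ^ q
  have hw : Continuous w := (Real.continuous_rpow_const hp.le).mul
    ((continuous_const.sub continuous_id).rpow_const fun _ ↦ Or.inr hq.le)
  have hderiv (x : ℝ) (hx : x ∈ Ioo (0 : ℝ) 1) : HasDerivAt (fun x ↦ w x • f x)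
      ((x ^ (p - 1) * (1 - x) ^ (q - 1)) • (x * (1 - x) * f' x + (p - (p + q) * x) * f x)) x := by
    have hx' : 0 < 1 - x := sub_pos.2 hx.2
    have hpow := (Real.hasDerivAt_rpow_const (p := p) (Or.inl hx.1.ne')).mul
      (((hasDerivAt_id x).const_sub 1).rpow_const (p := q) (Or.inl hx'.ne'))
    convert! hpow.smul (hf x) using 1
    simp only [id, Pi.mul_apply, Real.rpow_sub_one hx.1.ne', Real.rpow_sub_one hx'.ne',
      Complex.real_smul]
    push_cast
    have h₀ : (x : ℂ) ≠ 0 := mod_cast hx.1.ne'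
    have h₁ : (1 - x : ℂ) ≠ 0 := mod_cast hx'.ne'
    field_simp
    ring
  -- the boundary terms in the integral of the derivative of `w • f` vanish
  have hftc := intervalIntegral.integral_eq_sub_of_hasDerivAt_of_le zero_le_one
    (hw.smul hcont).continuousOn hderiv
    ((intervalIntegrable_rpow_mul_one_sub_rpow hp hq).smul_continuousOn (by fun_prop))
  rw [integral_betaMeasure hp hq, hftc]
  simp [w, Real.zero_rpow hp.ne', Real.zero_rpow hq.ne']

/-! ### The Gegenbauer integral -/

/-- The point at parameter `x` of the segment from `e⁻¹` to `e`. For `‖e‖ = 1` this is a vertical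
chord of the unit circle, with `e⁻¹` playing the role of the conjugate of `e`. -/
noncomputable def chordPoint (e : ℂ) (x : ℝ) : ℂ := (1 - x) * e⁻¹ + x * e

theorem hasDerivAt_chordPoint (e : ℂ) (x : ℝ) : HasDerivAt (chordPoint e) (e - e⁻¹) x := by
  have hx := (hasDerivAt_id x).ofReal_comp
  convert! ((hx.const_sub 1).mul_const e⁻¹).add (hx.mul_const e) using 1
  simp
  ring

@[fun_prop]
theorem continuous_chordPoint (e : ℂ) : Continuous (chordPoint e) := by
  unfold chordPoint
  fun_prop

theorem chordPoint_quadratic {e : ℂ} (he : e ≠ 0) (x : ℝ) :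
    chordPoint e x ^ 2 - (e + e⁻¹) * chordPoint e x + 1 = -(x * (1 - x) * (e - e⁻¹) ^ 2) := by
  unfold chordPoint
  field_simp
  ring

theorem one_sub_chordPoint_mul_self {e : ℂ} (he : e ≠ 0) (x : ℝ) :
    1 - chordPoint e x * e = x * (-e * (e - e⁻¹)) := by
  unfold chordPoint
  field_simp
  ring

theorem one_sub_chordPoint_mul_inv {e : ℂ} (he : e ≠ 0) (x : ℝ) :
    1 - chordPoint e x * e⁻¹ = (1 - x : ℝ) * (e⁻¹ * (e - e⁻¹)) := by
  unfold chordPoint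
  push_cast
  field_simp
  ring

section UnitCircle

variable {e : ℂ} {x : ℝ}

theorem norm_chordPoint_le_one (he : ‖e‖ = 1) (hx : x ∈ Icc (0 : ℝ) 1) :
    ‖chordPoint e x‖ ≤ 1 := by
  have := convex_closedBall (0 : ℂ) 1 (x := e⁻¹) (by simp [he]) (y := e) (by simp [he])
    (sub_nonneg.2 hx.2) hx.1 (sub_add_cancel 1 x)
  simpa [chordPoint] using this

theorem norm_chordPoint_lt_one (he : ‖e‖ = 1) (hne : e ≠ e⁻¹) (hx : x ∈ Ioo (0 : ℝ) 1) :
    ‖chordPoint e x‖ < 1 := by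
  have := norm_combo_lt_of_ne (x := e⁻¹) (y := e) (by simp [he]) he.le hne.symm
    (sub_pos.2 hx.2) hx.1 (sub_add_cancel 1 x)
  simpa [chordPoint] using this

theorem norm_one_sub_sq (he : ‖e‖ = 1) : ‖1 - e ^ 2‖ = ‖e - e⁻¹‖ := by
  have he0 : e ≠ 0 := norm_ne_zero_iff.1 (by simp [he])
  rw [show 1 - e ^ 2 = -e * (e - e⁻¹) by field_simp; ring, norm_mul, norm_neg, he, one_mul]

theorem norm_one_sub_chordPoint_sq_le (he : ‖e‖ = 1) (hx : x ∈ Icc (0 : ℝ) 1) :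
    ‖1 - chordPoint e x ^ 2‖ ≤ ‖e - e⁻¹‖ := by
  have he0 : e ≠ 0 := norm_ne_zero_iff.1 (by simp [he])
  have hinv : ‖1 - e⁻¹ ^ 2‖ = ‖e - e⁻¹‖ := by
    rw [norm_one_sub_sq (by simp [he]), inv_inv, norm_sub_rev]
  have hsplit : 1 - chordPoint e x ^ 2 =
      ((1 - x) ^ 2 : ℝ) * (1 - e⁻¹ ^ 2) + (x ^ 2 : ℝ) * (1 - e ^ 2) := by
    unfold chordPoint
    push_cast
    field_simp
    ring
  calc ‖1 - chordPoint e x ^ 2‖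
      ≤ (1 - x) ^ 2 * ‖1 - e⁻¹ ^ 2‖ + x ^ 2 * ‖1 - e ^ 2‖ := by
        rw [hsplit]
        refine (norm_add_le _ _).trans_eq ?_
        rw [norm_mul, norm_mul, Complex.norm_of_nonneg (sq_nonneg _),
          Complex.norm_of_nonneg (sq_nonneg _)]
    _ = (1 - 2 * (x * (1 - x))) * ‖e - e⁻¹‖ := by
        rw [hinv, norm_one_sub_sq he]
        ring
    _ ≤ ‖e - e⁻¹‖ := mul_le_of_le_one_left (norm_nonneg _)
        (by linarith [mul_nonneg hx.1 (sub_nonneg.2 hx.2)])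

end UnitCircle

section GegenbauerRepresentation

variable {a c p ν : ℝ} {e : ℂ}

theorem integrable_chordPoint_pow (hp : 0 < p) (e : ℂ) (n : ℕ) :
    Integrable (fun x ↦ chordPoint e x ^ n) (betaMeasure p p) :=
  integrable_betaMeasure_of_continuous hp hp (by fun_prop)

theorem integral_chordPoint_pow_stein (hp : 0 < p) (he : e ≠ 0) (hc : e + e⁻¹ = 2 * c) (n : ℕ) :
    ∫ x, (n * chordPoint e x ^ (n - 1) * (chordPoint e x ^ 2 - 2 * c * chordPoint e x + 1) +
      2 * p * chordPoint e x ^ n * (chordPoint e x - c)) ∂betaMeasure p p = 0 := by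
  have hderiv (x : ℝ) : HasDerivAt (fun x ↦ (e - e⁻¹) * chordPoint e x ^ n)
      ((e - e⁻¹) * (n * chordPoint e x ^ (n - 1) * (e - e⁻¹))) x :=
    ((hasDerivAt_chordPoint e x).pow n).const_mul _
  rw [← neg_eq_zero, ← integral_neg, ← integral_betaMeasure_stein hp hp hderiv (by fun_prop)]
  congr with x
  have hcenter : chordPoint e x - c = (x - 1 / 2) * (e - e⁻¹) := by
    rw [chordPoint]
    linear_combination (1 / 2 : ℂ) * hc
  rw [← hc, chordPoint_quadratic he, hcenter]
  ring

theorem integral_chordPoint (hp : 0 < p) (he : e ≠ 0) (hc : e + e⁻¹ = 2 * c) :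
    ∫ x, chordPoint e x ∂betaMeasure p p = c := by
  have := isProbabilityMeasureBeta hp hp
  have hint : Integrable (chordPoint e) (betaMeasure p p) := by
    simpa using integrable_chordPoint_pow hp e 1
  have h := integral_chordPoint_pow_stein hp he hc 0
  simp only [Nat.cast_zero, zero_mul, zero_add, pow_zero, mul_one] at h
  rw [integral_const_mul, integral_sub hint (integrable_const _), integral_const, probReal_univ,
    one_smul] at h
  have hp0 : (2 * p : ℂ) ≠ 0 := mod_cast (by positivity : 2 * p ≠ 0)
  exact sub_eq_zero.1 ((mul_eq_zero.1 h).resolve_left hp0)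

theorem integral_chordPoint_pow_recurrence (hp : 0 < p) (he : e ≠ 0) (hc : e + e⁻¹ = 2 * c)
    (m : ℕ) :
    (m + 1 + 2 * p) * ∫ x, chordPoint e x ^ (m + 2) ∂betaMeasure p p =
      (2 * (m + 1) + 2 * p) * c * (∫ x, chordPoint e x ^ (m + 1) ∂betaMeasure p p) -
        (m + 1) * ∫ x, chordPoint e x ^ m ∂betaMeasure p p := by
  have hint (C : ℂ) (n : ℕ) := (integrable_chordPoint_pow hp e n).const_mul C
  rw [← sub_eq_zero, ← integral_chordPoint_pow_stein hp he hc (m + 1)]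
  simp only [← integral_const_mul]
  rw [← integral_sub (hint _ _) (hint _ _), ← integral_sub (hint _ _)]
  swap
  · exact (hint _ _).sub (hint _ _)
  congr with x
  push_cast
  ring

theorem jacobiR_self_eq_integral (ha : -(1 / 2) < a) (he : e ≠ 0) (hc : e + e⁻¹ = 2 * c) (n : ℕ) :
    (jacobiR a a n c : ℂ) = ∫ x, chordPoint e x ^ n ∂betaMeasure (a + 1 / 2) (a + 1 / 2) := by
  have ha' : -1 < a := by linarith
  have hp : 0 < a + 1 / 2 := by linarith
  have := isProbabilityMeasureBeta hp hp
  induction n using Nat.twoStepInduction with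
  | zero =>
    simp only [jacobiR_zero ha', pow_zero, integral_const, probReal_univ, one_smul,
      Complex.ofReal_one]
  | one => simpa only [jacobiR_self_one ha', pow_one] using (integral_chordPoint hp he hc).symm
  | more m ih0 ih1 =>
    have hne : ((m + 1 + (2 * a + 1) : ℝ) : ℂ) ≠ 0 :=
      mod_cast (by linarith [m.cast_nonneg (α := ℝ)] : (m + 1 + (2 * a + 1) : ℝ) ≠ 0)
    have hint := integral_chordPoint_pow_recurrence hp he hc m
    have hjacobi := congrArg ((↑) : ℝ → ℂ) (jacobiR_self_recurrence ha' c m)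
    refine mul_left_cancel₀ hne ?_
    rw [← ih0, ← ih1] at hint
    push_cast at hint hjacobi ⊢
    linear_combination hjacobi - hint

theorem abs_jacobiR_self_le_one (ha : -(1 / 2) < a) (he : ‖e‖ = 1) (hc : e + e⁻¹ = 2 * c) (n : ℕ) :
    |jacobiR a a n c| ≤ 1 := by
  have hp : 0 < a + 1 / 2 := by linarith
  have := isProbabilityMeasureBeta hp hp
  rw [← Real.norm_eq_abs, ← Complex.norm_real,
    jacobiR_self_eq_integral ha (norm_ne_zero_iff.1 (by simp [he])) hc]
  refine (norm_integral_le_of_norm_le_const (C := 1) ?_).trans_eq (by rw [probReal_univ, mul_one])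
  filter_upwards [ae_betaMeasure_mem_Ioo _ _] with x hx
  rw [norm_pow]
  exact pow_le_one₀ (norm_nonneg _) (norm_chordPoint_le_one he (Ioo_subset_Icc_self hx))

theorem summable_fracDiffTerm_jacobiR (ha : -(1 / 2) < a) (hν : 0 ≤ ν) (he : ‖e‖ = 1)
    (hc : e + e⁻¹ = 2 * c) (k : ℕ) :
    Summable (fracDiffTerm 2 ν (fun n ↦ jacobiR a a n c) k) := by
  refine (summable_abs_cesaroA hν).of_norm_bounded fun j ↦ ?_
  rw [fracDiffTerm, Real.norm_eq_abs, abs_mul]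
  exact mul_le_of_le_one_right (abs_nonneg _) (abs_jacobiR_self_le_one ha he hc _)

theorem fracDiff_jacobiR_eq_integral (ha : -(1 / 2) < a) (hν : 0 ≤ ν) (he : ‖e‖ = 1)
    (hne : e ≠ e⁻¹) (hc : e + e⁻¹ = 2 * c) (k : ℕ) :
    (fracDiff 2 ν (fun n ↦ jacobiR a a n c) k : ℂ) =
      ∫ x, chordPoint e x ^ k * (1 - chordPoint e x ^ 2) ^ (ν : ℂ)
        ∂betaMeasure (a + 1 / 2) (a + 1 / 2) := by
  have hp : 0 < a + 1 / 2 := by linarith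
  have := isProbabilityMeasureBeta hp hp
  have hsum : HasSum (fun j ↦ ∫ x, (cesaroA (-ν - 1) j : ℂ) * chordPoint e x ^ (k + 2 * j)
      ∂betaMeasure (a + 1 / 2) (a + 1 / 2)) (∫ x, chordPoint e x ^ k *
        (1 - chordPoint e x ^ 2) ^ (ν : ℂ) ∂betaMeasure (a + 1 / 2) (a + 1 / 2)) := by
    refine hasSum_integral_of_dominated_convergence (fun j _ ↦ |cesaroA (-ν - 1) j|)
      (fun j ↦ (by fun_prop : Continuous _).aestronglyMeasurable) (fun j ↦ ?_)
      (ae_of_all _ fun _ ↦ summable_abs_cesaroA hν) (integrable_const _) ?_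
    all_goals filter_upwards [ae_betaMeasure_mem_Ioo _ _] with x hx
    · rw [norm_mul, norm_pow, Complex.norm_real, Real.norm_eq_abs]
      exact mul_le_of_le_one_right (abs_nonneg _)
        (pow_le_one₀ (norm_nonneg _) (norm_chordPoint_le_one he (Ioo_subset_Icc_self hx)))
    · have hlt : ‖chordPoint e x ^ 2‖ < 1 := by
        rw [norm_pow]
        exact pow_lt_one₀ (norm_nonneg _) (norm_chordPoint_lt_one he hne hx) two_ne_zero
      convert! (hasSum_cesaroA_mul_pow ν hlt).mul_left (chordPoint e x ^ k) using 2 with j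
      ring
  refine (Complex.hasSum_ofReal.2 (summable_fracDiffTerm_jacobiR ha hν he hc k).hasSum).unique ?_
  convert! hsum using 2 with j
  rw [integral_const_mul, ← jacobiR_self_eq_integral ha (norm_ne_zero_iff.1 (by simp [he])) hc,
    fracDiffTerm, Complex.ofReal_mul]

theorem abs_fracDiff_jacobiR_le (ha : -(1 / 2) < a) (hν : 0 ≤ ν) (he : ‖e‖ = 1)
    (hne : e ≠ e⁻¹) (hc : e + e⁻¹ = 2 * c) (k : ℕ) :
    |fracDiff 2 ν (fun n ↦ jacobiR a a n c) k| ≤ ‖e - e⁻¹‖ ^ ν := by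
  have hp : 0 < a + 1 / 2 := by linarith
  have := isProbabilityMeasureBeta hp hp
  rw [← Real.norm_eq_abs, ← Complex.norm_real, fracDiff_jacobiR_eq_integral ha hν he hne hc]
  refine (norm_integral_le_of_norm_le_const (C := ‖e - e⁻¹‖ ^ ν) ?_).trans_eq
    (by rw [probReal_univ, mul_one])
  filter_upwards [ae_betaMeasure_mem_Ioo _ _] with x hx
  have hx' := Ioo_subset_Icc_self hx
  rw [norm_mul, norm_pow, Complex.norm_cpow_real, ← one_mul (‖e - e⁻¹‖ ^ ν)]
  gcongr
  · exact pow_le_one₀ (norm_nonneg _) (norm_chordPoint_le_one he hx')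
  · exact norm_one_sub_chordPoint_sq_le he hx'

end GegenbauerRepresentation

/-! ### Real estimates -/

theorem rpow_le_rpow_add_rpow {l y u : ℝ} (hl : 0 < l) (hly : l ≤ y) (hyu : y ≤ u) (g : ℝ) :
    y ^ g ≤ l ^ g + u ^ g := by
  have hy := hl.trans_le hly
  have hu := hy.trans_le hyu
  rcases le_total 0 g with hg | hg
  · exact le_add_of_nonneg_of_le (by positivity) (Real.rpow_le_rpow hy.le hyu hg)
  · exact le_add_of_le_of_nonneg (Real.rpow_le_rpow_of_nonpos hl hly hg) (by positivity)

theorem one_add_rpow_le_mul_exp_half (q : ℝ) {y : ℝ} (hy : 0 ≤ y) :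
    (1 + y) ^ q ≤ (2 * max q 1) ^ max q 1 * Real.exp (y / 2) := by
  set Q := max q 1
  have hQ : 1 ≤ Q := le_max_right _ _
  have hexp : 1 + y ≤ 2 * Q * Real.exp (y / (2 * Q)) := by
    calc 1 + y ≤ 2 * Q * (y / (2 * Q) + 1) := by
          rw [mul_add, mul_div_cancel₀ _ (by positivity)]
          linarith
      _ ≤ 2 * Q * Real.exp (y / (2 * Q)) := by gcongr; exact Real.add_one_le_exp _
  calc (1 + y) ^ q ≤ (1 + y) ^ Q := Real.rpow_le_rpow_of_exponent_le (by linarith) (le_max_left _ _)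
    _ ≤ (2 * Q * Real.exp (y / (2 * Q))) ^ Q := by gcongr
    _ = (2 * Q) ^ Q * Real.exp (y / 2) := by
        rw [Real.mul_rpow (by positivity) (Real.exp_pos _).le, ← Real.exp_mul]
        congr 2
        field_simp

theorem add_rpow_mul_exp_neg_le (q : ℝ) {b s x : ℝ} (hs : 0 < s) (hbs : 1 ≤ b * s) (hx : 0 ≤ x) :
    (x + s) ^ q * Real.exp (-(b * x)) ≤
      (2 * max q 1) ^ max q 1 * s ^ q * Real.exp (-(b / 2 * x)) := by
  have hquot : x / s ≤ b * x := by
    rw [div_le_iff₀ hs]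
    nlinarith
  have hrpow : (x + s) ^ q ≤ s ^ q * ((2 * max q 1) ^ max q 1 * Real.exp (b * x / 2)) := by
    rw [show x + s = s * (1 + x / s) by field_simp; ring,
      Real.mul_rpow hs.le (by positivity)]
    refine mul_le_mul_of_nonneg_left ?_ (by positivity)
    exact (one_add_rpow_le_mul_exp_half q (by positivity)).trans (by gcongr)
  calc (x + s) ^ q * Real.exp (-(b * x))
      ≤ s ^ q * ((2 * max q 1) ^ max q 1 * Real.exp (b * x / 2)) * Real.exp (-(b * x)) := by gcongr
    _ = (2 * max q 1) ^ max q 1 * s ^ q * (Real.exp (b * x / 2) * Real.exp (-(b * x))) := by ring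
    _ = (2 * max q 1) ^ max q 1 * s ^ q * Real.exp (-(b / 2 * x)) := by
        rw [← Real.exp_add]
        ring_nf

theorem integrableOn_rpow_mul_exp_neg_mul {p b : ℝ} (hp : 0 < p) (hb : 0 < b) :
    IntegrableOn (fun x : ℝ ↦ x ^ (p - 1) * Real.exp (-(b * x))) (Ioi 0) := by
  simpa [neg_mul] using
    integrableOn_rpow_mul_exp_neg_mul_rpow (by linarith : -1 < p - 1) one_pos hb

theorem intervalIntegrable_one_sub_rpow_mul_exp {p b ρ : ℝ} (hp : 0 < p) (hb : 0 < b)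
    (hρ : ρ ∈ Icc (0 : ℝ) 1) :
    IntervalIntegrable (fun r : ℝ ↦ (1 - r) ^ (p - 1) * Real.exp (-(b * (1 - r)))) volume 0 ρ := by
  have h : IntervalIntegrable (fun x : ℝ ↦ x ^ (p - 1) * Real.exp (-(b * x))) volume
      (1 - 0) (1 - ρ) := by
    rw [sub_zero, intervalIntegrable_iff, uIoc_of_ge (by linarith [hρ.1])]
    exact (integrableOn_rpow_mul_exp_neg_mul hp hb).mono_set fun x hx ↦
      (sub_nonneg.2 hρ.2).trans_lt hx.1
  simpa using h.comp_sub_left 1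

theorem integral_one_sub_rpow_mul_exp_le {p b ρ : ℝ} (hp : 0 < p) (hb : 0 < b)
    (hρ : ρ ∈ Icc (0 : ℝ) 1) :
    ∫ r in (0 : ℝ)..ρ, (1 - r) ^ (p - 1) * Real.exp (-(b * (1 - r))) ≤
      b ^ (-p) * Real.Gamma p := by
  rw [intervalIntegral.integral_comp_sub_left (fun x ↦ x ^ (p - 1) * Real.exp (-(b * x))),
    intervalIntegral.integral_of_le (by linarith [hρ.1])]
  calc ∫ x in Ioc (1 - ρ) (1 - 0), x ^ (p - 1) * Real.exp (-(b * x))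
      ≤ ∫ x in Ioi (0 : ℝ), x ^ (p - 1) * Real.exp (-(b * x)) := by
        refine setIntegral_mono_set (integrableOn_rpow_mul_exp_neg_mul hp hb) ?_
          (LE.le.eventuallyLE fun x hx ↦ (sub_nonneg.2 hρ.2).trans_lt hx.1)
        filter_upwards [ae_restrict_mem measurableSet_Ioi] with x hx
        have : 0 < x := hx
        positivity
    _ = b ^ (-p) * Real.Gamma p := by
        rw [Real.integral_rpow_mul_exp_neg_mul_Ioi hp hb, one_div, Real.inv_rpow hb.le,
          Real.rpow_neg hb.le]

/-! ### Contour shift -/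

/-- The holomorphic function on the unit disc whose restriction to the chord from `e⁻¹` to `e` is,
up to a constant factor, the integrand of the Beta integral for the fractional differences of the
ultraspherical polynomials, with the Beta weight being the product of the last two factors. -/
noncomputable def discKernel (p ν : ℝ) (k : ℕ) (e z : ℂ) : ℂ :=
  z ^ k * (1 - z ^ 2) ^ (ν : ℂ) *
    ((1 - z * e) ^ ((p - 1 : ℝ) : ℂ) * (1 - z * e⁻¹) ^ ((p - 1 : ℝ) : ℂ))

theorem ofReal_mul_cpow {r : ℝ} (hr : 0 < r) {w : ℂ} (hw : w ≠ 0) (s : ℂ) :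
    ((r : ℂ) * w) ^ s = (r : ℂ) ^ s * w ^ s := by
  have hr' : (r : ℂ) ≠ 0 := Complex.ofReal_ne_zero.2 hr.ne'
  rw [Complex.cpow_def_of_ne_zero (mul_ne_zero hr' hw), Complex.log_ofReal_mul hr hw, add_mul,
    Complex.exp_add, Complex.cpow_def_of_ne_zero hw, Complex.cpow_def_of_ne_zero hr',
    Complex.ofReal_log hr.le]

theorem one_sub_mem_slitPlane {w : ℂ} (hw : ‖w‖ < 1) : 1 - w ∈ Complex.slitPlane := by
  simpa [sub_eq_add_neg] using Complex.mem_slitPlane_of_norm_lt_one (z := -w) (by simpa using hw)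

theorem norm_one_sub_le_two_mul {w : ℂ} (hw : ‖w‖ ≤ 1) {ρ : ℝ} (hρ : ρ ∈ Icc (0 : ℝ) 1) :
    ‖1 - w‖ ≤ 2 * ‖1 - ρ * w‖ := by
  have hρ' : 0 ≤ 1 - ρ := sub_nonneg.2 hρ.2
  have hdist : 1 - ρ ≤ ‖1 - ρ * w‖ := by
    have := norm_sub_norm_le (1 : ℂ) (ρ * w)
    rw [norm_one, norm_mul, Complex.norm_of_nonneg hρ.1] at this
    linarith [mul_le_of_le_one_right hρ.1 hw]
  calc ‖1 - w‖ = ‖(1 - ρ * w) - (1 - ρ : ℝ) * w‖ := by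
        congr 1
        push_cast
        ring
    _ ≤ ‖1 - ρ * w‖ + (1 - ρ) * ‖w‖ := by
        refine (norm_sub_le _ _).trans_eq ?_
        rw [norm_mul _ w, Complex.norm_of_nonneg hρ']
    _ ≤ 2 * ‖1 - ρ * w‖ := by linarith [mul_le_of_le_one_right hρ' hw]

theorem discKernel_inv (p ν : ℝ) (k : ℕ) (e z : ℂ) :
    discKernel p ν k e⁻¹ z = discKernel p ν k e z := by
  rw [discKernel, discKernel, inv_inv, mul_comm ((1 - z * e⁻¹) ^ _)]

theorem norm_discKernel (p ν : ℝ) (k : ℕ) (e z : ℂ) :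
    ‖discKernel p ν k e z‖ =
      ‖z‖ ^ k * ‖1 - z ^ 2‖ ^ ν * (‖1 - z * e‖ ^ (p - 1) * ‖1 - z * e⁻¹‖ ^ (p - 1)) := by
  simp only [discKernel, norm_mul, norm_pow, Complex.norm_cpow_real]

theorem segment_integral_mul_eq_sub {F G : ℂ → ℂ} {s : Set ℂ} (hs : Convex ℝ s)
    (hF : ContinuousOn F s) (hG : ∀ z ∈ s, HasDerivAt G (F z) z) {z w : ℂ} (hz : z ∈ s)
    (hw : w ∈ s) :
    (∫ x in (0 : ℝ)..1, F (AffineMap.lineMap z w x)) * (w - z) = G w - G z := by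
  have hmem {x : ℝ} (hx : x ∈ uIcc (0 : ℝ) 1) : AffineMap.lineMap z w x ∈ s :=
    hs.lineMap_mem hz hw (uIcc_of_le (zero_le_one (α := ℝ)) ▸ hx)
  rw [← intervalIntegral.integral_mul_const, intervalIntegral.integral_eq_sub_of_hasDerivAt
    (f := fun x : ℝ ↦ G (AffineMap.lineMap z w x))
    (fun x hx ↦ (hG _ (hmem hx)).comp x AffineMap.hasDerivAt_lineMap)
    (ContinuousOn.intervalIntegrable ?_)]
  · simp
  · refine (hF.comp ?_ fun x hx ↦ hmem hx).mul continuousOn_const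
    exact AffineMap.lineMap_continuous.continuousOn

section UnitCircle

variable {p ν ρ r x : ℝ} {e : ℂ}

theorem differentiableOn_discKernel (p ν : ℝ) (k : ℕ) (he : ‖e‖ = 1) :
    DifferentiableOn ℂ (discKernel p ν k e) (Metric.ball 0 1) := by
  intro z hz
  rw [mem_ball_zero_iff] at hz
  have hsq : ‖z ^ 2‖ < 1 := by
    rw [norm_pow]
    exact pow_lt_one₀ (norm_nonneg _) hz two_ne_zero
  have hmul {f : ℂ} (hf : ‖f‖ = 1) : ‖z * f‖ < 1 := by rwa [norm_mul, hf, mul_one]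
  have hsq' : DifferentiableAt ℂ (fun z : ℂ ↦ (1 - z ^ 2) ^ (ν : ℂ)) z :=
    DifferentiableAt.cpow_const (by fun_prop) (one_sub_mem_slitPlane hsq)
  have hmul' {f : ℂ} (hf : ‖f‖ = 1) :
      DifferentiableAt ℂ (fun z : ℂ ↦ (1 - z * f) ^ ((p - 1 : ℝ) : ℂ)) z :=
    DifferentiableAt.cpow_const (by fun_prop) (one_sub_mem_slitPlane (hmul hf))
  exact (((differentiableAt_id.pow k).mul hsq').mul
    ((hmul' he).mul (hmul' (by simp [he])))).differentiableWithinAt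

theorem exists_discKernel_chordPoint_eq (p ν : ℝ) (k : ℕ) (he : ‖e‖ = 1) (hne : e ≠ e⁻¹) :
    ∃ κ : ℂ, ‖κ‖ = ‖e - e⁻¹‖ ^ (2 * (p - 1)) ∧ ∀ x ∈ Ioo (0 : ℝ) 1,
      discKernel p ν k e (chordPoint e x) = κ * ((x ^ (p - 1) * (1 - x) ^ (p - 1)) •
        (chordPoint e x ^ k * (1 - chordPoint e x ^ 2) ^ (ν : ℂ))) := by
  have he0 : e ≠ 0 := norm_ne_zero_iff.1 (by simp [he])
  have hσ : 0 < ‖e - e⁻¹‖ := norm_pos_iff.2 (sub_ne_zero.2 hne)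
  refine ⟨(-e * (e - e⁻¹)) ^ ((p - 1 : ℝ) : ℂ) * (e⁻¹ * (e - e⁻¹)) ^ ((p - 1 : ℝ) : ℂ), ?_,
    fun x hx ↦ ?_⟩
  · rw [norm_mul, Complex.norm_cpow_real, Complex.norm_cpow_real, norm_mul, norm_mul, norm_neg,
      norm_inv, he, inv_one, one_mul, ← Real.rpow_add hσ, two_mul]
  · have hx' : 0 < 1 - x := sub_pos.2 hx.2
    rw [discKernel, one_sub_chordPoint_mul_self he0, one_sub_chordPoint_mul_inv he0,
      ofReal_mul_cpow hx.1 (mul_ne_zero (neg_ne_zero.2 he0) (sub_ne_zero.2 hne)),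
      ofReal_mul_cpow hx' (mul_ne_zero (inv_ne_zero he0) (sub_ne_zero.2 hne)),
      ← Complex.ofReal_cpow hx.1.le, ← Complex.ofReal_cpow hx'.le, Complex.real_smul,
      Complex.ofReal_mul]
    ring

theorem sq_mul_le_norm_one_sub_mul_norm_one_sub (he : ‖e‖ = 1) (hρ : ρ ∈ Icc (0 : ℝ) 1)
    (hx : x ∈ Icc (0 : ℝ) 1) :
    ‖e - e⁻¹‖ ^ 2 / 4 * (x * (1 - x)) ≤
      ‖1 - ρ * chordPoint e x * e‖ * ‖1 - ρ * chordPoint e x * e⁻¹‖ := by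
  have he0 : e ≠ 0 := norm_ne_zero_iff.1 (by simp [he])
  have hx' : 0 ≤ 1 - x := sub_nonneg.2 hx.2
  have hz := norm_chordPoint_le_one he hx
  have hself : x * ‖e - e⁻¹‖ ≤ 2 * ‖1 - ρ * chordPoint e x * e‖ := by
    have := norm_one_sub_le_two_mul (w := chordPoint e x * e) (by simpa [he] using hz) hρ
    rwa [one_sub_chordPoint_mul_self he0, norm_mul, norm_mul, norm_neg, he, one_mul,
      Complex.norm_of_nonneg hx.1, ← mul_assoc (ρ : ℂ)] at this
  have hinv : (1 - x) * ‖e - e⁻¹‖ ≤ 2 * ‖1 - ρ * chordPoint e x * e⁻¹‖ := by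
    have := norm_one_sub_le_two_mul (w := chordPoint e x * e⁻¹) (by simpa [he] using hz) hρ
    rwa [one_sub_chordPoint_mul_inv he0, norm_mul, norm_mul, norm_inv, he, inv_one, one_mul,
      Complex.norm_of_nonneg hx', ← mul_assoc (ρ : ℂ)] at this
  linarith [mul_le_mul hself hinv (mul_nonneg hx' (norm_nonneg _)) (by positivity)]

theorem norm_discKernel_mul_chordPoint_le (p : ℝ) (hν : 0 ≤ ν) (k : ℕ) (he : ‖e‖ = 1)
    (hne : e ≠ e⁻¹) (hρ : ρ ∈ Icc (0 : ℝ) 1) (hx : x ∈ Ioo (0 : ℝ) 1) :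
    ‖discKernel p ν k e (ρ * chordPoint e x)‖ ≤
      2 ^ ν * ((‖e - e⁻¹‖ ^ 2 / 4) ^ (p - 1) * (x ^ (p - 1) * (1 - x) ^ (p - 1)) +
        4 ^ (p - 1)) := by
  have hσ : 0 < ‖e - e⁻¹‖ := norm_pos_iff.2 (sub_ne_zero.2 hne)
  have hx0 := hx.1
  have hx1 : 0 < 1 - x := sub_pos.2 hx.2
  have hx' := Ioo_subset_Icc_self hx
  have hlower := sq_mul_le_norm_one_sub_mul_norm_one_sub he hρ hx'
  set z := (ρ : ℂ) * chordPoint e x with hz_def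
  have hz : ‖z‖ ≤ 1 := by
    rw [hz_def, norm_mul, Complex.norm_of_nonneg hρ.1]
    exact mul_le_one₀ hρ.2 (norm_nonneg _) (norm_chordPoint_le_one he hx')
  have le_two {w : ℂ} (hw : ‖w‖ ≤ 1) : ‖1 - w‖ ≤ 2 := by
    linarith [norm_sub_le (1 : ℂ) w, norm_one (α := ℂ)]
  have hself : ‖1 - z * e‖ ≤ 2 := le_two (by rwa [norm_mul, he, mul_one])
  have hinv : ‖1 - z * e⁻¹‖ ≤ 2 := le_two (by rwa [norm_mul, norm_inv, he, inv_one, mul_one])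
  have hsq : ‖1 - z ^ 2‖ ≤ 2 := le_two (by rw [norm_pow]; exact pow_le_one₀ (norm_nonneg _) hz)
  have hupper : ‖1 - z * e‖ * ‖1 - z * e⁻¹‖ ≤ 4 := by
    linarith [mul_le_mul hself hinv (norm_nonneg _) zero_le_two]
  rw [norm_discKernel, ← Real.mul_rpow (norm_nonneg _) (norm_nonneg _),
    ← Real.mul_rpow hx0.le hx1.le, ← Real.mul_rpow (by positivity) (by positivity)]
  gcongr
  · exact (mul_le_of_le_one_left (by positivity) (pow_le_one₀ (norm_nonneg _) hz)).trans
      (Real.rpow_le_rpow (norm_nonneg _) hsq hν)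
  · exact rpow_le_rpow_add_rpow (by positivity) hlower hupper _

theorem tendsto_integral_discKernel (hp : 0 < p) (hν : 0 ≤ ν) (k : ℕ) (he : ‖e‖ = 1)
    (hne : e ≠ e⁻¹) :
    Tendsto (fun ρ : ℝ ↦ ∫ x in (0 : ℝ)..1, discKernel p ν k e (ρ * chordPoint e x)) (𝓝[<] 1)
      (𝓝 (∫ x in (0 : ℝ)..1, discKernel p ν k e (chordPoint e x))) := by
  have hdiff := differentiableOn_discKernel p ν k he
  have hρ : ∀ᶠ ρ : ℝ in 𝓝[<] 1, ρ ∈ Ioo (0 : ℝ) 1 := Ioo_mem_nhdsLT zero_lt_one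
  have hIoo : ∀ᵐ x : ℝ, x ∈ uIoc 0 1 → x ∈ Ioo (0 : ℝ) 1 := by
    filter_upwards [Measure.ae_ne volume (1 : ℝ)] with x hx1 hx
    rw [uIoc_of_le zero_le_one] at hx
    exact ⟨hx.1, lt_of_le_of_ne hx.2 hx1⟩
  refine intervalIntegral.tendsto_integral_filter_of_dominated_convergence
    (fun x ↦ 2 ^ ν * ((‖e - e⁻¹‖ ^ 2 / 4) ^ (p - 1) * (x ^ (p - 1) * (1 - x) ^ (p - 1)) +
      4 ^ (p - 1))) ?_ ?_ ?_ ?_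
  · filter_upwards [hρ] with ρ hρ
    rw [uIoc_of_le zero_le_one]
    refine ContinuousOn.aestronglyMeasurable ?_ measurableSet_Ioc
    refine hdiff.continuousOn.comp (t := Metric.ball 0 1) (by fun_prop) fun x hx ↦ ?_
    rw [mem_ball_zero_iff, norm_mul, Complex.norm_of_nonneg hρ.1.le]
    exact (mul_le_of_le_one_right hρ.1.le
      (norm_chordPoint_le_one he (Ioc_subset_Icc_self hx))).trans_lt hρ.2
  · filter_upwards [hρ] with ρ hρ
    filter_upwards [hIoo] with x hIoo hx
    exact norm_discKernel_mul_chordPoint_le p hν k he hne (Ioo_subset_Icc_self hρ) (hIoo hx)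
  · exact (((intervalIntegrable_rpow_mul_one_sub_rpow hp hp).const_mul _).add
      intervalIntegrable_const).const_mul _
  · filter_upwards [hIoo] with x hIoo hx
    have hz := mem_ball_zero_iff.2 (norm_chordPoint_lt_one he hne (hIoo hx))
    have hcont := (hdiff.differentiableAt (Metric.isOpen_ball.mem_nhds hz)).continuousAt
    have hscale : Tendsto (fun ρ : ℝ ↦ ρ * chordPoint e x) (𝓝[<] 1) (𝓝 (chordPoint e x)) := by
      have : Continuous fun ρ : ℝ ↦ ρ * chordPoint e x := by fun_prop
      simpa using this.tendsto' 1 _ rfl |>.mono_left nhdsWithin_le_nhds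
    exact hcont.tendsto.comp hscale

theorem integral_chord_eq_sub_integral_radial {F : ℂ → ℂ}
    (hF : DifferentiableOn ℂ F (Metric.ball 0 1)) (he : ‖e‖ = 1) (hρ : ρ ∈ Ioo (0 : ℝ) 1) :
    (∫ x in (0 : ℝ)..1, F (ρ * chordPoint e x)) * (ρ * (e - e⁻¹)) =
      (∫ r in (0 : ℝ)..ρ, F (r * e)) * e - (∫ r in (0 : ℝ)..ρ, F (r * e⁻¹)) * e⁻¹ := by
  obtain ⟨G, hG⟩ := hF.isExactOn_ball
  have hsegment {z w : ℂ} (hz : z ∈ Metric.ball (0 : ℂ) 1) (hw : w ∈ Metric.ball (0 : ℂ) 1) :=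
    segment_integral_mul_eq_sub (convex_ball 0 1) hF.continuousOn hG hz hw
  have hmem {f : ℂ} (hf : ‖f‖ = 1) : ρ * f ∈ Metric.ball (0 : ℂ) 1 := by
    rw [mem_ball_zero_iff, norm_mul, hf, mul_one, Complex.norm_of_nonneg hρ.1.le]
    exact hρ.2
  have hradial {f : ℂ} (hf : ‖f‖ = 1) : (∫ r in (0 : ℝ)..ρ, F (r * f)) * f = G (ρ * f) - G 0 := by
    have hsub := intervalIntegral.smul_integral_comp_mul_left (a := 0) (b := 1)
      (fun r : ℝ ↦ F (r * f)) ρ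
    rw [mul_zero, mul_one] at hsub
    rw [← hsegment (Metric.mem_ball_self one_pos) (hmem hf), ← hsub, Complex.real_smul]
    simp only [AffineMap.lineMap_apply_module, smul_zero, zero_add, Complex.real_smul, sub_zero]
    push_cast
    simp only [mul_comm (ρ : ℂ), mul_assoc]
  have hinv : ‖e⁻¹‖ = 1 := by simp [he]
  rw [hradial he, hradial hinv, sub_sub_sub_cancel_right, ← hsegment (hmem hinv) (hmem he), mul_sub]
  simp only [AffineMap.lineMap_apply_module, chordPoint, Complex.real_smul]
  push_cast
  congr! 4
  ring

end UnitCircle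

/-! ### Estimate on the radii -/

section RadialEstimate

variable {p ν ρ r : ℝ} {e : ℂ}

theorem norm_one_sub_mul_sq_le (he : ‖e‖ = 1) (hr : r ∈ Icc (0 : ℝ) 1) :
    ‖1 - r * e ^ 2‖ ≤ 1 - r + ‖e - e⁻¹‖ := by
  calc ‖1 - r * e ^ 2‖ = ‖(1 - r : ℝ) + r * (1 - e ^ 2)‖ := by
        congr 1
        push_cast
        ring
    _ ≤ (1 - r) + r * ‖e - e⁻¹‖ := by
        refine (norm_add_le _ _).trans_eq ?_
        rw [norm_mul, Complex.norm_of_nonneg (sub_nonneg.2 hr.2), Complex.norm_of_nonneg hr.1,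
          norm_one_sub_sq he]
    _ ≤ 1 - r + ‖e - e⁻¹‖ := by
        gcongr
        exact mul_le_of_le_one_left (norm_nonneg _) hr.2

theorem le_three_mul_norm_one_sub_mul_sq (he : ‖e‖ = 1) (hr : r ∈ Icc (0 : ℝ) 1) :
    1 - r + ‖e - e⁻¹‖ ≤ 3 * ‖1 - r * e ^ 2‖ := by
  have hdist : 1 - r ≤ ‖1 - r * e ^ 2‖ := by
    have := norm_sub_norm_le (1 : ℂ) (r * e ^ 2)
    rwa [norm_one, norm_mul, norm_pow, he, one_pow, mul_one, Complex.norm_of_nonneg hr.1] at this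
  have := norm_one_sub_le_two_mul (w := e ^ 2) (by simp [he]) hr
  rw [norm_one_sub_sq he] at this
  linarith

theorem pow_le_exp_one_mul_exp_neg (hr : r ∈ Icc (0 : ℝ) 1) (k : ℕ) :
    r ^ k ≤ Real.exp 1 * Real.exp (-((k + 1) * (1 - r))) := by
  calc r ^ k ≤ Real.exp (-(1 - r)) ^ k := by
        gcongr
        · exact hr.1
        · linarith [Real.add_one_le_exp (-(1 - r))]
    _ = Real.exp (-(k * (1 - r))) := by
        rw [← Real.exp_nat_mul, mul_neg]
    _ ≤ Real.exp 1 * Real.exp (-((k + 1) * (1 - r))) := by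
        rw [← Real.exp_add, Real.exp_le_exp]
        linarith [hr.1]

theorem norm_discKernel_radial_le (p : ℝ) (hν : 0 ≤ ν) (k : ℕ) (he : ‖e‖ = 1)
    (hr : r ∈ Ico (0 : ℝ) 1) :
    ‖discKernel p ν k e (r * e)‖ ≤ 2 ^ ν * ((1 / 3) ^ (p - 1) + 1) * Real.exp 1 *
      ((1 - r) ^ (p - 1) * ((1 - r + ‖e - e⁻¹‖) ^ (ν + p - 1) *
        Real.exp (-((k + 1) * (1 - r))))) := by
  have hr' := Ico_subset_Icc_self hr
  have hr0 := hr.1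
  have hr1 : 0 < 1 - r := sub_pos.2 hr.2
  set u := 1 - r + ‖e - e⁻¹‖
  have hu : 0 < u := by positivity
  have hinv : ‖1 - r * e * e⁻¹‖ = 1 - r := by
    rw [mul_assoc, mul_inv_cancel₀ (norm_ne_zero_iff.1 (by simp [he])), mul_one,
      ← Complex.ofReal_one, ← Complex.ofReal_sub, Complex.norm_of_nonneg hr1.le]
  have hself : ‖1 - r * e * e‖ ^ (p - 1) ≤ ((1 / 3) ^ (p - 1) + 1) * u ^ (p - 1) := by
    have hlower := le_three_mul_norm_one_sub_mul_sq he hr'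
    rw [mul_assoc, ← sq, add_mul, one_mul, ← Real.mul_rpow (by positivity) hu.le]
    exact rpow_le_rpow_add_rpow (by positivity) (by linarith) (norm_one_sub_mul_sq_le he hr') _
  have hsq : ‖1 - (r * e) ^ 2‖ ≤ 2 * u := by
    have := norm_one_sub_mul_sq_le (r := r ^ 2) he ⟨by positivity, pow_le_one₀ hr0 hr.2.le⟩
    rw [Complex.ofReal_pow, ← mul_pow] at this
    nlinarith [norm_nonneg (e - e⁻¹)]
  have hnorm : ‖r * e‖ = r := by rw [norm_mul, he, mul_one, Complex.norm_of_nonneg hr0]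
  rw [norm_discKernel, hinv, hnorm, show ν + p - 1 = ν + (p - 1) by ring, Real.rpow_add hu]
  calc r ^ k * ‖1 - (r * e) ^ 2‖ ^ ν * (‖1 - r * e * e‖ ^ (p - 1) * (1 - r) ^ (p - 1))
      ≤ Real.exp 1 * Real.exp (-((k + 1) * (1 - r))) * (2 * u) ^ ν *
          (((1 / 3) ^ (p - 1) + 1) * u ^ (p - 1) * (1 - r) ^ (p - 1)) := by
        gcongr
        exact pow_le_exp_one_mul_exp_neg hr' k
    _ = _ := by
        rw [Real.mul_rpow zero_le_two hu.le]
        ring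

theorem exists_norm_integral_discKernel_radial_le (hp : 0 < p) (hν : 0 ≤ ν) :
    ∃ C, ∀ (k : ℕ) {e : ℂ}, ‖e‖ = 1 → 1 ≤ (k + 1) * ‖e - e⁻¹‖ → ∀ ρ ∈ Ioo (0 : ℝ) 1,
      ‖∫ r in (0 : ℝ)..ρ, discKernel p ν k e (r * e)‖ ≤
        C * (‖e - e⁻¹‖ ^ (ν + p - 1) * (k + 1) ^ (-p)) := by
  set A : ℝ := 2 ^ ν * ((1 / 3) ^ (p - 1) + 1) * Real.exp 1
  set q := ν + p - 1
  set B : ℝ := (2 * max q 1) ^ max q 1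
  refine ⟨A * B * (2 ^ p * Real.Gamma p), fun k e he hk ρ hρ ↦ ?_⟩
  set σ := ‖e - e⁻¹‖
  set b : ℝ := (k + 1) / 2 with hb_def
  have hb : 0 < b := by positivity
  have hσ : 0 < σ := pos_of_mul_pos_right (one_pos.trans_le hk) (by positivity)
  have hpointwise : ∀ r ∈ Ioc 0 ρ, ‖discKernel p ν k e (r * e)‖ ≤
      A * B * σ ^ q * ((1 - r) ^ (p - 1) * Real.exp (-(b * (1 - r)))) := fun r hr ↦ by
    have hr1 : r < 1 := hr.2.trans_lt hρ.2
    have hr' : 0 ≤ 1 - r := sub_nonneg.2 hr1.le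
    calc ‖discKernel p ν k e (r * e)‖
        ≤ A * ((1 - r) ^ (p - 1) * ((1 - r + σ) ^ q * Real.exp (-((k + 1) * (1 - r))))) :=
          norm_discKernel_radial_le p hν k he ⟨hr.1.le, hr1⟩
      _ ≤ A * ((1 - r) ^ (p - 1) * (B * σ ^ q * Real.exp (-(b * (1 - r))))) := by
          gcongr A * (_ * ?_)
          exact add_rpow_mul_exp_neg_le q hσ hk hr'
      _ = _ := by ring
  calc ‖∫ r in (0 : ℝ)..ρ, discKernel p ν k e (r * e)‖
      ≤ ∫ r in (0 : ℝ)..ρ, A * B * σ ^ q * ((1 - r) ^ (p - 1) * Real.exp (-(b * (1 - r)))) :=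
        intervalIntegral.norm_integral_le_of_norm_le hρ.1.le (ae_of_all _ hpointwise)
          ((intervalIntegrable_one_sub_rpow_mul_exp hp hb (Ioo_subset_Icc_self hρ)).const_mul _)
    _ ≤ A * B * σ ^ q * (b ^ (-p) * Real.Gamma p) := by
        rw [intervalIntegral.integral_const_mul]
        gcongr
        exact integral_one_sub_rpow_mul_exp_le hp hb (Ioo_subset_Icc_self hρ)
    _ = _ := by
        rw [hb_def, Real.div_rpow (by positivity) zero_le_two, Real.rpow_neg zero_le_two,
          div_inv_eq_mul]
        ring

theorem exists_norm_integral_discKernel_chord_le (hp : 0 < p) (hν : 0 ≤ ν) :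
    ∃ C, ∀ (k : ℕ) {e : ℂ}, ‖e‖ = 1 → 1 ≤ (k + 1) * ‖e - e⁻¹‖ →
      ‖∫ x in (0 : ℝ)..1, discKernel p ν k e (chordPoint e x)‖ * ‖e - e⁻¹‖ ≤
        C * (‖e - e⁻¹‖ ^ (ν + p - 1) * (k + 1) ^ (-p)) := by
  obtain ⟨C, hC⟩ := exists_norm_integral_discKernel_radial_le hp hν
  refine ⟨2 * C, fun k e he hk ↦ ?_⟩
  have hinv : ‖e⁻¹‖ = 1 := by simp [he]
  have hne : e ≠ e⁻¹ := fun h ↦ by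
    rw [← h, sub_self, norm_zero, mul_zero] at hk
    exact hk.not_gt one_pos
  have hself := hC k he hk
  have hconj := hC k hinv (by rwa [inv_inv, norm_sub_rev])
  simp only [discKernel_inv, inv_inv, norm_sub_rev e⁻¹ e] at hconj
  have hlim := (((tendsto_integral_discKernel hp hν k he hne).mul
    ((Complex.continuous_ofReal.tendsto' 1 1 (by simp)).mono_left nhdsWithin_le_nhds
      |>.mul_const (e - e⁻¹))).norm)
  rw [one_mul, norm_mul] at hlim
  refine le_of_tendsto hlim ?_
  filter_upwards [Ioo_mem_nhdsLT zero_lt_one] with ρ hρ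
  rw [integral_chord_eq_sub_integral_radial (differentiableOn_discKernel p ν k he) he hρ]
  refine (norm_sub_le _ _).trans ?_
  rw [norm_mul, norm_mul, he, hinv, mul_one, mul_one]
  linarith [hself ρ hρ, hconj ρ hρ]

end RadialEstimate

theorem beta_mul_rpow_mul_abs_fracDiff_jacobiR {a c ν : ℝ} (ha : -(1 / 2) < a) (hν : 0 ≤ ν)
    {e : ℂ} (he : ‖e‖ = 1) (hne : e ≠ e⁻¹) (hc : e + e⁻¹ = 2 * c) (k : ℕ) :
    beta (a + 1 / 2) (a + 1 / 2) * ‖e - e⁻¹‖ ^ (2 * (a + 1 / 2 - 1)) *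
        |fracDiff 2 ν (fun n ↦ jacobiR a a n c) k| =
      ‖∫ x in (0 : ℝ)..1, discKernel (a + 1 / 2) ν k e (chordPoint e x)‖ := by
  have hp : 0 < a + 1 / 2 := by linarith
  have hbeta := beta_pos hp hp
  obtain ⟨κ, hκ, hκF⟩ := exists_discKernel_chordPoint_eq (a + 1 / 2) ν k he hne
  have hchord : ∫ x in (0 : ℝ)..1, discKernel (a + 1 / 2) ν k e (chordPoint e x) =
      κ * (beta (a + 1 / 2) (a + 1 / 2) • (fracDiff 2 ν (fun n ↦ jacobiR a a n c) k : ℂ)) := by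
    rw [fracDiff_jacobiR_eq_integral ha hν he hne hc, integral_betaMeasure hp hp,
      smul_inv_smul₀ hbeta.ne', ← intervalIntegral.integral_const_mul]
    refine intervalIntegral.integral_congr_ae ?_
    filter_upwards [Measure.ae_ne volume (1 : ℝ)] with x hx1 hx
    rw [uIoc_of_le zero_le_one] at hx
    exact hκF x ⟨hx.1, lt_of_le_of_ne hx.2 hx1⟩
  rw [hchord, norm_mul, hκ, norm_smul, Complex.norm_real, Real.norm_of_nonneg hbeta.le,
    Real.norm_eq_abs]
  ring

theorem exists_abs_fracDiff_jacobiR_le {a ν : ℝ} (ha : -(1 / 2) < a) (hν : 0 ≤ ν) :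
    ∃ C, ∀ (k : ℕ) {c : ℝ} {e : ℂ}, ‖e‖ = 1 → e ≠ e⁻¹ → e + e⁻¹ = 2 * c →
      |fracDiff 2 ν (fun n ↦ jacobiR a a n c) k| ≤
        C * ‖e - e⁻¹‖ ^ (ν - a - 1 / 2) * ((k : ℝ) + 1) ^ (-a - 1 / 2) := by
  have hp : 0 < a + 1 / 2 := by linarith
  have hbeta := beta_pos hp hp
  obtain ⟨C, hC⟩ := exists_norm_integral_discKernel_chord_le hp hν
  refine ⟨max 1 (C / beta (a + 1 / 2) (a + 1 / 2)), fun k c e he hne hc ↦ ?_⟩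
  have hσ : 0 < ‖e - e⁻¹‖ := norm_pos_iff.2 (sub_ne_zero.2 hne)
  set σ := ‖e - e⁻¹‖
  rw [mul_assoc, show -a - 1 / 2 = -(a + 1 / 2) by ring,
    show ν - a - 1 / 2 = ν - (a + 1 / 2) by ring]
  set p := a + 1 / 2
  rcases le_or_gt 1 ((k + 1) * σ) with hk | hk
  · refine le_trans ?_ (mul_le_mul_of_nonneg_right (le_max_right _ _) (by positivity))
    have hchord := hC k he hk
    rw [← beta_mul_rpow_mul_abs_fracDiff_jacobiR ha hν he hne hc] at hchord
    have hpow : σ ^ (ν + p - 1) = σ ^ (ν - p) * (σ ^ (2 * (p - 1)) * σ) := by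
      rw [← Real.rpow_add_one hσ.ne', ← Real.rpow_add hσ]
      ring_nf
    rw [div_mul_eq_mul_div, le_div_iff₀ hbeta]
    refine le_of_mul_le_mul_right ?_ (by positivity : 0 < σ ^ (2 * (p - 1)) * σ)
    rw [hpow] at hchord
    linarith
  · refine le_trans ?_ (mul_le_mul_of_nonneg_right (le_max_left _ _) (by positivity))
    have hσk : σ ≤ ((k : ℝ) + 1)⁻¹ := by
      rw [← one_div, le_div_iff₀ (by positivity), mul_comm]
      exact hk.le
    calc |fracDiff 2 ν (fun n ↦ jacobiR a a n c) k| ≤ σ ^ ν :=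
          abs_fracDiff_jacobiR_le ha hν he hne hc k
      _ = σ ^ (ν - p) * σ ^ p := by rw [← Real.rpow_add hσ, sub_add_cancel]
      _ ≤ σ ^ (ν - p) * ((k : ℝ) + 1)⁻¹ ^ p := by gcongr
      _ = 1 * (σ ^ (ν - p) * ((k : ℝ) + 1) ^ (-p)) := by
          rw [Real.inv_rpow (by positivity), Real.rpow_neg (by positivity), one_mul]

theorem exists_norm_eq_one_add_inv_eq_two_mul_cos {θ : ℝ} (hθ : θ ∈ Ioo 0 Real.pi) :
    ∃ e : ℂ, ‖e‖ = 1 ∧ e ≠ e⁻¹ ∧ e + e⁻¹ = 2 * (Real.cos θ : ℝ) ∧ ‖e - e⁻¹‖ = 2 * Real.sin θ := by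
  have hsin : 0 < Real.sin θ := Real.sin_pos_of_mem_Ioo hθ
  set e := Complex.exp (θ * Complex.I) with he
  have hinv : e⁻¹ = Complex.exp (-θ * Complex.I) := by rw [he, ← Complex.exp_neg, neg_mul]
  have hsub : ‖e - e⁻¹‖ = 2 * Real.sin θ := by
    have : e - e⁻¹ = (2 * Real.sin θ : ℝ) * Complex.I := by
      rw [hinv, he, Complex.exp_mul_I, Complex.exp_mul_I, Complex.cos_neg, Complex.sin_neg]
      push_cast
      ring
    rw [this, norm_mul, Complex.norm_I, mul_one, Complex.norm_of_nonneg (by positivity)]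
  refine ⟨e, Complex.norm_exp_ofReal_mul_I θ, fun h ↦ ?_, ?_, hsub⟩
  · rw [← h, sub_self, norm_zero] at hsub
    linarith
  · rw [hinv, he, Complex.ofReal_cos, ← Complex.two_cos]

theorem lemma4p5_general (α ν : ℝ) (hα : -(1 / 2) < α) (hν : 0 ≤ ν) :
    (∀ (k : ℕ) (θ : ℝ), θ ∈ Ioo 0 Real.pi →
      Summable (fracDiffTerm 2 ν (fun n ↦ jacobiR α α n (Real.cos θ)) k)) ∧
    (∃ K : ℝ, ∀ (k : ℕ) (θ : ℝ), θ ∈ Ioo 0 Real.pi →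
      |fracDiff 2 ν (fun n ↦ jacobiR α α n (Real.cos θ)) k| ≤ K * Real.sin θ ^ ν) ∧
    ∃ K : ℝ, ∀ (k : ℕ) (θ : ℝ), θ ∈ Ioo 0 Real.pi →
      |fracDiff 2 ν (fun n ↦ jacobiR α α n (Real.cos θ)) k| ≤
        K * Real.sin θ ^ (ν - α - 1 / 2) * ((k : ℝ) + 1) ^ (-α - 1 / 2) := by
  obtain ⟨C, hC⟩ := exists_abs_fracDiff_jacobiR_le hα hν
  refine ⟨fun k θ hθ ↦ ?_, ⟨2 ^ ν, fun k θ hθ ↦ ?_⟩,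
    ⟨C * 2 ^ (ν - α - 1 / 2), fun k θ hθ ↦ ?_⟩⟩
  all_goals
    have hsin : 0 < Real.sin θ := Real.sin_pos_of_mem_Ioo hθ
    obtain ⟨e, he, hne, hadd, hsub⟩ := exists_norm_eq_one_add_inv_eq_two_mul_cos hθ
  · exact summable_fracDiffTerm_jacobiR hα hν he hadd k
  · rw [← Real.mul_rpow zero_le_two hsin.le, ← hsub]
    exact abs_fracDiff_jacobiR_le hα hν he hne hadd k
  · rw [mul_assoc C, ← Real.mul_rpow zero_le_two hsin.le, ← hsub]
    exact hC k he hne hadd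

theorem lemma4p5 (α ν : ℝ) (hα : -(1 / 2) < α) (hν0 : 0 < ν) (hν : ν < α + 1 / 2) :
    (∀ (k : ℕ) (θ : ℝ), 0 < θ → θ < Real.pi / 2 →
      Summable (fracDiffTerm 2 ν (fun n => jacobiR α α n (Real.cos θ)) k)) ∧
    (∃ K : ℝ, ∀ (k : ℕ) (θ : ℝ), 0 < θ → θ < Real.pi / 2 →
      |fracDiff 2 ν (fun n => jacobiR α α n (Real.cos θ)) k| ≤ K * Real.sin θ ^ ν) ∧
    ((1 / 2 < α → (greatestIntLT (α + 1 / 2) : ℝ) ≤ ν) →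
      ∃ K : ℝ, ∀ (k : ℕ) (θ : ℝ), 0 < θ → θ < Real.pi / 2 →
        |fracDiff 2 ν (fun n => jacobiR α α n (Real.cos θ)) k| ≤
          K * Real.sin θ ^ (ν - α - 1 / 2) * ((k : ℝ) + 1) ^ (-α - 1 / 2)) := by
  obtain ⟨hsum, ⟨Ka, ha⟩, Kb, hb⟩ := lemma4p5_general α ν hα hν0.le
  have hmem {θ : ℝ} (h0 : 0 < θ) (h1 : θ < Real.pi / 2) : θ ∈ Ioo 0 Real.pi :=
    ⟨h0, h1.trans (half_lt_self Real.pi_pos)⟩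
  exact ⟨fun k θ h0 h1 ↦ hsum k θ (hmem h0 h1), ⟨Ka, fun k θ h0 h1 ↦ ha k θ (hmem h0 h1)⟩,
    fun _ ↦ ⟨Kb, fun k θ h0 h1 ↦ hb k θ (hmem h0 h1)⟩⟩
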